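/- Let $\beta\colon H\to\operatorname{Aut}(A)$ be an action of a discrete abelian group $H$ on a (not necessarily unital) $C^*$-algebra $A$, and let $A\rtimes_\beta H$ be the (full) crossed product, that is, the completion of the algebra of finite sums $\sum_{h\in H}a_hu_h$ with $a_h\in A$ in the norm $\|b\|=\sup\|(\pi\rtimes U)(b)\|$, where the supremum runs over all covariant representations $(\pi,U)$ of $(A,H,\beta)$ on Hilbert spaces and $(\pi\rtimes U)\big(\sum_h a_hu_h\big)=\sum_h\pi(a_h)U_h$. Let $\widehat\beta\colon\widehat H\to\operatorname{Aut}(A\rtimes_\beta H)$ be the dual action of the Pontryagin dual $\widehat H$, determined by $$\widehat\beta_x(a\,u_h)=\overline{\langle h,x\rangle}\,a\,u_h\qquad(a\in A,\ h\in H,\ x\in\widehat H).$$ Let $L\subseteq H$ be a subgroup, let $L^\perp=\{x\in\widehat H:\langle l,x\rangle=1\text{ for all }l\in L\}$ be its annihilator, and let $A\rtimes_\beta L$ be the crossed product by the restriction of $\beta$ to $L$. Then the canonical $*$-homomorphism $A\rtimes_\beta L\to A\rtimes_\beta H$, $a\,u_l\mapsto a\,u_l$, is isometric, and, when $A\rtimes_\beta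 L$ is viewed in this way as a subalgebra of $A\rtimes_\beta H$, $$A\rtimes_\beta L=(A\rtimes_\beta H)^{L^\perp,\widehat\beta}:=\{b\in A\rtimes_\beta H:\widehat\beta_x(b)=b\text{ for all }x\in L^\perp\}.$$ -/

import Mathlib

open scoped ENNReal

noncomputable section

namespace CStarCrossed

universe u v

variable {A : Type u} [NonUnitalCStarAlgebra A] {H : Type v} [Group H]

/-- A covariant representation `(π, U)` on a Hilbert space `K` of a C⋆-dynamical system
`(A, H, β)` with `H` discrete: a ⋆-representation `π` of `A` and a unitary representation `U`
of `H` with `U h * π a * (U h)⋆ = π (β h a)`. (Passing to cyclic subrepresentations shows that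
Hilbert spaces in `Type (max u v)` are large enough to compute the universal norm.) -/
structure CovariantRep (β : H →* (A ≃⋆ₐ[ℂ] A)) : Type (max u v + 1) where
  /-- the Hilbert space -/
  K : Type (max u v)
  [normedAddCommGroup : NormedAddCommGroup K]
  [innerProductSpace : InnerProductSpace ℂ K]
  [completeSpace : CompleteSpace K]
  /-- the representation of the algebra -/
  π : A →⋆ₙₐ[ℂ] (K →L[ℂ] K)
  /-- the unitary representation of the group -/
  U : H →* unitary (K →L[ℂ] K)
  covariant : ∀ (h : H) (a : A),
    (U h : K →L[ℂ] K) * π a * star (U h : K →L[ℂ] K) = π (β h a)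

attribute [instance] CovariantRep.normedAddCommGroup CovariantRep.innerProductSpace
  CovariantRep.completeSpace

variable (β : H →* (A ≃⋆ₐ[ℂ] A))

/-- The C⋆-algebra of all bounded families of operators, one for each covariant representation
(the block-diagonal operators on the Hilbert space of the universal covariant representation). -/
def UniversalOps : Type (max u v + 1) :=
  lp (fun ρ : CovariantRep β => ρ.K →L[ℂ] ρ.K) ∞

instance : NonUnitalCStarAlgebra (UniversalOps β) :=
  inferInstanceAs (NonUnitalCStarAlgebra (lp (fun ρ : CovariantRep β => ρ.K →L[ℂ] ρ.K) ∞))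

instance : CoeFun (UniversalOps β) (fun _ => ∀ ρ : CovariantRep β, ρ.K →L[ℂ] ρ.K) :=
  ⟨fun T => T.1⟩

variable {β} in
theorem UniversalOps.ext {S T : UniversalOps β} (h : ∀ ρ, S ρ = T ρ) : S = T :=
  Subtype.ext (funext h)

variable {β}

theorem CovariantRep.U_mul_π (ρ : CovariantRep β) (h : H) (a : A) :
    (ρ.U h : ρ.K →L[ℂ] ρ.K) * ρ.π a = ρ.π (β h a) * (ρ.U h : ρ.K →L[ℂ] ρ.K) := by
  rw [← ρ.covariant, mul_assoc, Unitary.coe_star_mul_self, mul_one]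

theorem CovariantRep.norm_π_mul_U_le (ρ : CovariantRep β) (a : A) (h : H) :
    ‖ρ.π a * (ρ.U h : ρ.K →L[ℂ] ρ.K)‖ ≤ ‖a‖ := by
  rw [CStarRing.norm_mul_coe_unitary]
  exact NonUnitalStarAlgHom.norm_apply_le ρ.π a

variable (β)

/-- The element `a u_h` in the universal covariant representation. -/
def au (a : A) (h : H) : UniversalOps β :=
  ⟨fun ρ => ρ.π a * (ρ.U h : ρ.K →L[ℂ] ρ.K),
    memℓp_infty ⟨‖a‖, by rintro _ ⟨ρ, rfl⟩; exact ρ.norm_π_mul_U_le a h⟩⟩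

theorem au_apply (a : A) (h : H) (ρ : CovariantRep β) :
    au β a h ρ = ρ.π a * (ρ.U h : ρ.K →L[ℂ] ρ.K) := rfl

/-- `(a u_h) (b u_k) = a β_h(b) u_{hk}`. -/
theorem au_mul_au (a b : A) (h k : H) :
    au β a h * au β b k = au β (a * β h b) (h * k) := by
  refine UniversalOps.ext fun ρ => ?_
  change (ρ.π a * (ρ.U h : ρ.K →L[ℂ] ρ.K)) * (ρ.π b * (ρ.U k : ρ.K →L[ℂ] ρ.K))
    = ρ.π (a * β h b) * (ρ.U (h * k) : ρ.K →L[ℂ] ρ.K)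
  rw [map_mul, map_mul, Submonoid.coe_mul, mul_assoc, ← mul_assoc _ (ρ.π b), ρ.U_mul_π]
  simp only [mul_assoc]

/-- `(a u_h)⋆ = β_{h⁻¹}(a⋆) u_{h⁻¹}`. -/
theorem star_au (a : A) (h : H) :
    star (au β a h) = au β (β h⁻¹ (star a)) h⁻¹ := by
  refine UniversalOps.ext fun ρ => ?_
  change star (ρ.π a * (ρ.U h : ρ.K →L[ℂ] ρ.K))
    = ρ.π (β h⁻¹ (star a)) * (ρ.U h⁻¹ : ρ.K →L[ℂ] ρ.K)
  have : star (ρ.U h : ρ.K →L[ℂ] ρ.K) = (ρ.U h⁻¹ : ρ.K →L[ℂ] ρ.K) := by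
    rw [map_inv, ← Unitary.star_eq_inv, Unitary.coe_star]
  rw [star_mul, ← map_star, this, ρ.U_mul_π]

/-- The algebraic crossed product: the finite sums `∑ a_h u_h`. -/
def algCrossedProduct : NonUnitalStarSubalgebra ℂ (UniversalOps β) where
  toSubmodule := Submodule.span ℂ {x | ∃ (a : A) (h : H), x = au β a h}
  mul_mem' := by
    intro x y hx hy
    induction hx, hy using Submodule.span_induction₂ with
    | mem_mem x y hx hy =>
      obtain ⟨a, h, rfl⟩ := hx
      obtain ⟨b, k, rfl⟩ := hy
      exact Submodule.subset_span ⟨_, _, au_mul_au β a b h k⟩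
    | zero_left => simp
    | zero_right => simp
    | add_left x y z _ _ _ h₁ h₂ => rw [add_mul]; exact Submodule.add_mem _ h₁ h₂
    | add_right x y z _ _ _ h₁ h₂ => rw [mul_add]; exact Submodule.add_mem _ h₁ h₂
    | smul_left r x y _ _ h => rw [smul_mul_assoc]; exact Submodule.smul_mem _ r h
    | smul_right r x y _ _ h => rw [mul_smul_comm]; exact Submodule.smul_mem _ r h
  star_mem' := by
    intro x hx
    induction hx using Submodule.span_induction with
    | mem x hx =>
      obtain ⟨a, h, rfl⟩ := hx
      exact Submodule.subset_span ⟨_, _, star_au β a h⟩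
    | zero => simp
    | add x y _ _ h₁ h₂ => rw [star_add]; exact Submodule.add_mem _ h₁ h₂
    | smul r x _ h => rw [star_smul]; exact Submodule.smul_mem _ _ h

/-- The (full) crossed product `A ⋊_β H` of the discrete group `H`, as a ⋆-subalgebra of the
algebra of bounded families: the closure of the algebraic crossed product in the norm
`‖b‖ = sup ‖(π ⋊ U)(b)‖`, the supremum over all covariant representations `(π, U)`. -/
def crossedProduct : NonUnitalStarSubalgebra ℂ (UniversalOps β) :=
  (algCrossedProduct β).topologicalClosure

theorem isClosed_crossedProduct : IsClosed (crossedProduct β : Set (UniversalOps β)) :=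
  NonUnitalStarSubalgebra.isClosed_topologicalClosure _

/-- The (full) crossed product `A ⋊_β H` as a C⋆-algebra. -/
def CrossedProduct : Type (max u v + 1) := ↥(crossedProduct β)

instance : NonUnitalCStarAlgebra (CrossedProduct β) :=
  haveI : IsClosed (crossedProduct β : Set (UniversalOps β)) := isClosed_crossedProduct β
  inferInstanceAs (NonUnitalCStarAlgebra ↥(crossedProduct β))

/-- The inclusion of `A ⋊_β H` into the bounded families. -/
def CrossedProduct.val : CrossedProduct β →⋆ₙₐ[ℂ] UniversalOps β where
  toFun x := x.1
  map_smul' _ _ := rfl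
  map_zero' := rfl
  map_add' _ _ := rfl
  map_mul' _ _ := rfl
  map_star' _ := rfl

theorem CrossedProduct.val_injective : Function.Injective (CrossedProduct.val β) :=
  Subtype.val_injective

theorem au_mem (a : A) (h : H) : au β a h ∈ crossedProduct β :=
  NonUnitalStarSubalgebra.le_topologicalClosure _ (Submodule.subset_span ⟨a, h, rfl⟩)

/-- The element `a u_h` of `A ⋊_β H`. -/
def CrossedProduct.au (a : A) (h : H) : CrossedProduct β := ⟨CStarCrossed.au β a h, au_mem β a h⟩

variable {β}

theorem continuous_hom {B C : Type*} [NonUnitalCStarAlgebra B] [NonUnitalCStarAlgebra C]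
    (φ : B →⋆ₙₐ[ℂ] C) : Continuous φ :=
  AddMonoidHomClass.continuous_of_bound φ 1 fun x => by
    rw [one_mul]; exact NonUnitalStarAlgHom.norm_apply_le φ x

/-- A ⋆-homomorphism that maps every `a u_h` into a closed ⋆-subalgebra maps the
whole crossed product into it. -/
theorem map_mem_of_au {B : Type*} [NonUnitalCStarAlgebra B]
    (φ : UniversalOps β →⋆ₙₐ[ℂ] B) (S : NonUnitalStarSubalgebra ℂ B) (hS : IsClosed (S : Set B))
    (h : ∀ a h, φ (au β a h) ∈ S) {x : UniversalOps β} (hx : x ∈ crossedProduct β) :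
    φ x ∈ S := by
  have hφ : Continuous φ := continuous_hom φ
  have key : crossedProduct β ≤ S.comap φ := by
    refine NonUnitalStarSubalgebra.topologicalClosure_minimal _ ?_ (hS.preimage hφ)
    intro y hy
    change y ∈ Submodule.span ℂ _ at hy
    change φ y ∈ S
    induction hy using Submodule.span_induction with
    | mem x hx => obtain ⟨a, k, rfl⟩ := hx; exact h a k
    | zero => rw [map_zero]; exact zero_mem S
    | add x y _ _ h₁ h₂ => rw [map_add]; exact add_mem h₁ h₂
    | smul r x _ h => rw [map_smul]; exact SMulMemClass.smul_mem r h
  exact key hx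

/-- The ⋆-homomorphism between crossed products obtained by restricting one between the ambient
algebras that maps each `a u_h` into the target. -/
def CrossedProduct.map {H' : Type v} [Group H'] {β' : H' →* (A ≃⋆ₐ[ℂ] A)}
    (φ : UniversalOps β' →⋆ₙₐ[ℂ] UniversalOps β)
    (hφ : ∀ a h, φ (CStarCrossed.au β' a h) ∈ crossedProduct β) :
    CrossedProduct β' →⋆ₙₐ[ℂ] CrossedProduct β where
  toFun x := ⟨φ x.1, map_mem_of_au φ (crossedProduct β) (isClosed_crossedProduct β) hφ x.2⟩
  map_smul' c x := Subtype.ext (map_smul φ c x.1)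
  map_zero' := Subtype.ext (map_zero φ)
  map_add' x y := Subtype.ext (map_add φ x.1 y.1)
  map_mul' x y := Subtype.ext (map_mul φ x.1 y.1)
  map_star' x := Subtype.ext (map_star φ x.1)

/-- A ⋆-homomorphism on `A ⋊_β H` is determined by its values on the elements `a u_h`. -/
theorem crossedProduct_hom_ext {B : Type*} [NonUnitalCStarAlgebra B]
    {φ ψ : CrossedProduct β →⋆ₙₐ[ℂ] B}
    (h : ∀ a h, φ (CrossedProduct.au β a h) = ψ (CrossedProduct.au β a h)) : φ = ψ := by
  have hφ : Continuous φ := continuous_hom φ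
  have hψ : Continuous ψ := continuous_hom ψ
  have le : ∀ z, z ∈ Submodule.span ℂ {x | ∃ (a : A) (h : H), x = au β a h} →
      z ∈ crossedProduct β := fun z hz => NonUnitalStarSubalgebra.le_topologicalClosure _ hz
  have alg : ∀ y (hy : y ∈ Submodule.span ℂ {x | ∃ (a : A) (h : H), x = au β a h})
      (hy' : y ∈ crossedProduct β),
      φ (⟨y, hy'⟩ : ↥(crossedProduct β)) = ψ (⟨y, hy'⟩ : ↥(crossedProduct β)) := by
    intro y hy
    induction hy using Submodule.span_induction with
    | mem x hx => obtain ⟨a, k, rfl⟩ := hx; exact fun _ => h a k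
    | zero => exact fun _ => (map_zero φ).trans (map_zero ψ).symm
    | add x y hx hy h₁ h₂ =>
      intro _
      have e := congrArg₂ (· + ·) (h₁ (le x hx)) (h₂ (le y hy))
      exact ((map_add φ (⟨x, le x hx⟩ : ↥(crossedProduct β))
        (⟨y, le y hy⟩ : ↥(crossedProduct β))).trans e).trans (map_add ψ _ _).symm
    | smul r x hx h₁ =>
      intro _
      have e := congrArg (r • ·) (h₁ (le x hx))
      exact ((map_smul φ r (⟨x, le x hx⟩ : ↥(crossedProduct β))).trans e).trans
        (map_smul ψ r _).symm
  refine DFunLike.ext _ _ fun z => ?_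
  have hcl : IsClosed {z : CrossedProduct β | φ z = ψ z} := isClosed_eq hφ hψ
  have hz : z.1 ∈ closure (algCrossedProduct β : Set (UniversalOps β)) := z.2
  have hemb : Topology.IsInducing (fun w : CrossedProduct β => w.1) :=
    (Topology.IsInducing.subtypeVal :
      Topology.IsInducing (Subtype.val : ↥(crossedProduct β) → UniversalOps β))
  have : z ∈ closure {w : CrossedProduct β | w.1 ∈ algCrossedProduct β} := by
    rw [hemb.closure_eq_preimage_closure_image]
    refine closure_mono ?_ hz
    exact fun y hy => ⟨⟨y, le y hy⟩, hy, rfl⟩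
  exact closure_minimal (fun w hw => alg w.1 hw w.2) hcl this

/-- Pulling back bounded families of operators along a map of covariant representations
that does not change the Hilbert space. -/
def reindex {H' : Type v} [Group H'] {β' : H' →* (A ≃⋆ₐ[ℂ] A)}
    (π : ∀ ρ : CovariantRep β, A →⋆ₙₐ[ℂ] (ρ.K →L[ℂ] ρ.K))
    (U : ∀ ρ : CovariantRep β, H' →* unitary (ρ.K →L[ℂ] ρ.K))
    (cov : ∀ ρ h a, (U ρ h : ρ.K →L[ℂ] ρ.K) * π ρ a * star (U ρ h : ρ.K →L[ℂ] ρ.K)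
      = π ρ (β' h a)) :
    UniversalOps β' →⋆ₙₐ[ℂ] UniversalOps β where
  toFun T := ⟨fun ρ => T ⟨ρ.K, π ρ, U ρ, cov ρ⟩, by
    obtain ⟨C, hC⟩ := (lp.memℓp T).bddAbove
    exact memℓp_infty ⟨C, by rintro _ ⟨ρ, rfl⟩; exact hC ⟨_, rfl⟩⟩⟩
  map_smul' _ _ := rfl
  map_zero' := rfl
  map_add' _ _ := rfl
  map_mul' _ _ := rfl
  map_star' _ := rfl

section Inclusion

variable (β) (L : Subgroup H)

/-- The restriction of the action `β` to the subgroup `L`. -/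
abbrev restrictAction : L →* (A ≃⋆ₐ[ℂ] A) := β.comp L.subtype

/-- A bounded family indexed by the covariant representations of `(A, L)` is evaluated at the
restrictions to `L` of the covariant representations of `(A, H)`. -/
def inclusionOps : UniversalOps (restrictAction β L) →⋆ₙₐ[ℂ] UniversalOps β :=
  reindex (fun ρ => ρ.π) (fun ρ => ρ.U.comp L.subtype) (fun ρ h a => ρ.covariant h a)

theorem inclusionOps_au (a : A) (l : L) :
    inclusionOps β L (au (restrictAction β L) a l) = au β a (l : H) := rfl

/-- The canonical ⋆-homomorphism `A ⋊ L → A ⋊ H`, which sends `a u_l` to `a u_l`. -/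
def inclusion : CrossedProduct (restrictAction β L) →⋆ₙₐ[ℂ] CrossedProduct β :=
  CrossedProduct.map (inclusionOps β L) fun a l => by
    rw [inclusionOps_au]; exact au_mem β a (l : H)

theorem inclusion_au (a : A) (l : L) :
    inclusion β L (CrossedProduct.au (restrictAction β L) a l) = CrossedProduct.au β a (l : H) :=
  rfl

end Inclusion

section Dual

variable [TopologicalSpace H] (β)

/-- The unitary representation `h ↦ conj ⟨h, x⟩ U_h`. -/
def twistU (x : PontryaginDual H) (ρ : CovariantRep β) : H →* unitary (ρ.K →L[ℂ] ρ.K) where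
  toFun h := ⟨(starRingEnd ℂ (x h : ℂ)) • (ρ.U h : ρ.K →L[ℂ] ρ.K), by
    have h1 : (starRingEnd ℂ (x h : ℂ)) * (x h : ℂ) = 1 := by
      rw [← Circle.coe_inv_eq_conj, ← Circle.coe_mul, inv_mul_cancel, Circle.coe_one]
    have h2 : (x h : ℂ) * (starRingEnd ℂ (x h : ℂ)) = 1 := by rw [mul_comm, h1]
    rw [Unitary.mem_iff, star_smul, smul_mul_smul_comm, smul_mul_smul_comm,
      Unitary.star_mul_self_of_mem (ρ.U h).2, Unitary.mul_star_self_of_mem (ρ.U h).2,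
      Complex.star_def, Complex.conj_conj, h1, h2, one_smul]
    exact ⟨rfl, rfl⟩⟩
  map_one' := by ext1; simp
  map_mul' h k := by
    ext1
    simp only [map_mul, Circle.coe_mul, Submonoid.coe_mul, smul_mul_smul_comm]

theorem twistU_apply (x : PontryaginDual H) (ρ : CovariantRep β) (h : H) :
    (twistU β x ρ h : ρ.K →L[ℂ] ρ.K)
      = (starRingEnd ℂ (x h : ℂ)) • (ρ.U h : ρ.K →L[ℂ] ρ.K) := rfl

theorem twistU_covariant (x : PontryaginDual H) (ρ : CovariantRep β) (h : H) (a : A) :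
    (twistU β x ρ h : ρ.K →L[ℂ] ρ.K) * ρ.π a * star (twistU β x ρ h : ρ.K →L[ℂ] ρ.K)
      = ρ.π (β h a) := by
  have h1 : (starRingEnd ℂ (x h : ℂ)) * (x h : ℂ) = 1 := by
    rw [← Circle.coe_inv_eq_conj, ← Circle.coe_mul, inv_mul_cancel, Circle.coe_one]
  rw [twistU_apply, star_smul, ← ρ.covariant, smul_mul_assoc, smul_mul_smul_comm,
    Complex.star_def, Complex.conj_conj, h1, one_smul]

/-- Evaluation of a bounded family at the twisted covariant representations
`(π, conj x · U)`. -/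
def dualOps (x : PontryaginDual H) : UniversalOps β →⋆ₙₐ[ℂ] UniversalOps β :=
  reindex (fun ρ => ρ.π) (twistU β x) (twistU_covariant β x)

theorem dualOps_au (x : PontryaginDual H) (a : A) (h : H) :
    dualOps β x (au β a h) = (starRingEnd ℂ (x h : ℂ)) • au β a h := by
  refine UniversalOps.ext fun ρ => ?_
  change ρ.π a * ((starRingEnd ℂ (x h : ℂ)) • (ρ.U h : ρ.K →L[ℂ] ρ.K))
    = (starRingEnd ℂ (x h : ℂ)) • (ρ.π a * (ρ.U h : ρ.K →L[ℂ] ρ.K))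
  rw [mul_smul_comm]

/-- The endomorphism `β̂_x` of the crossed product. -/
def dualEnd (x : PontryaginDual H) : CrossedProduct β →⋆ₙₐ[ℂ] CrossedProduct β :=
  CrossedProduct.map (dualOps β x) fun a h => by
    rw [dualOps_au]; exact SMulMemClass.smul_mem _ (au_mem β a h)

theorem dualEnd_au (x : PontryaginDual H) (a : A) (h : H) :
    dualEnd β x (CrossedProduct.au β a h)
      = (starRingEnd ℂ (x h : ℂ)) • CrossedProduct.au β a h :=
  Subtype.ext (dualOps_au β x a h)

theorem dualEnd_mul (x y : PontryaginDual H) :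
    dualEnd β (x * y) = (dualEnd β x).comp (dualEnd β y) := by
  refine crossedProduct_hom_ext fun a h => ?_
  rw [NonUnitalStarAlgHom.comp_apply, dualEnd_au, dualEnd_au, map_smul, dualEnd_au, smul_smul]
  have : (x * y) h = x h * y h := rfl
  rw [this, Circle.coe_mul, map_mul, mul_comm]

theorem dualEnd_one : dualEnd β (1 : PontryaginDual H) = NonUnitalStarAlgHom.id ℂ _ := by
  refine crossedProduct_hom_ext fun a h => ?_
  rw [dualEnd_au, PontryaginDual.one_apply, Circle.coe_one, map_one, one_smul]
  rfl

/-- The dual action `β̂` of the dual group on the crossed product, determined by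
`β̂_x (a u_h) = conj ⟨h, x⟩ a u_h`. -/
def dualAction : PontryaginDual H →* (CrossedProduct β ≃⋆ₐ[ℂ] CrossedProduct β) where
  toFun x :=
    { toFun := dualEnd β x
      invFun := dualEnd β x⁻¹
      left_inv := fun b => by
        rw [← NonUnitalStarAlgHom.comp_apply, ← dualEnd_mul, inv_mul_cancel, dualEnd_one]; rfl
      right_inv := fun b => by
        rw [← NonUnitalStarAlgHom.comp_apply, ← dualEnd_mul, mul_inv_cancel, dualEnd_one]; rfl
      map_mul' := map_mul _
      map_add' := map_add _
      map_star' := map_star _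
      map_smul' := map_smul _ }
  map_one' := StarAlgEquiv.ext fun b => DFunLike.congr_fun (dualEnd_one β) b
  map_mul' x y := StarAlgEquiv.ext fun b => DFunLike.congr_fun (dualEnd_mul β x y) b

theorem dualAction_au (x : PontryaginDual H) (a : A) (h : H) :
    dualAction β x (CrossedProduct.au β a h)
      = (starRingEnd ℂ (x h : ℂ)) • CrossedProduct.au β a h := dualEnd_au β x a h

end Dual

/-- The annihilator `L^⊥` of a subgroup `L` in the dual group. -/
def annihilator [TopologicalSpace H] (L : Subgroup H) : Subgroup (PontryaginDual H) where
  carrier := {x | ∀ l ∈ L, x l = 1}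
  one_mem' _ _ := rfl
  mul_mem' {x y} hx hy l hl := by
    change x l * y l = 1
    rw [hx l hl, hy l hl, mul_one]
  inv_mem' {x} hx l hl := by
    change (x l)⁻¹ = 1
    rw [hx l hl, inv_one]

/-- The fixed-point algebra `B^{M, γ}` of the restriction of an action `γ` to a subgroup `M`. -/
def fixedPointAlgebra {G : Type*} [Group G] {B : Type*} [NonUnitalCStarAlgebra B]
    (γ : G →* (B ≃⋆ₐ[ℂ] B)) (M : Subgroup G) : NonUnitalStarSubalgebra ℂ B where
  carrier := {b | ∀ g ∈ M, γ g b = b}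
  add_mem' hx hy g hg := by rw [map_add, hx g hg, hy g hg]
  zero_mem' g _ := map_zero _
  mul_mem' hx hy g hg := by rw [map_mul, hx g hg, hy g hg]
  smul_mem' c x hx g hg := by rw [map_smul, hx g hg]
  star_mem' hx g hg := by rw [map_star, hx g hg]

end CStarCrossed

end

open scoped ENNReal

noncomputable section

namespace CStarCrossed

/-! ### Weighted permutation operators on square-summable families. -/

section WeightedShift

variable {Q : Type*} {K : Type*} [NormedAddCommGroup K] [InnerProductSpace ℂ K]

/-! Isometry: a ⋆-homomorphism is contractive, so only `norm_le_norm_inclusion` is needed. A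
covariant representation `ρ` of `(A, L)` induces one of `(A, H)` on `ℓ²(H ⧸ L, K)`. Restricted to `A
⋊ L`, the induced representation preserves the fibre over the trivial coset and acts there as `ρ`
(`inducedRep_single`), so the norm in `A ⋊ H` dominates every `‖T ρ‖`.

Fixed points: one inclusion is seen on the generators `a u_l`. For the other, finite products of the
averages `(1 + β̂_x) / 2`, `x ∈ L^⊥`, take the place of integration over `L^⊥`. They are commuting
contractions that fix every fixed point. If `h ∉ L`, some `x ∈ L^⊥` has `⟨h, x⟩ ≠ 1`, and powers of
its average shrink `a u_h` to zero. Hence any element is moved arbitrarily close to the image of `A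
⋊ L` (`exists_dualAverages_norm_sub_lt`). A fixed point is not moved at all, so it lies in the
closure of this image, which is closed by the first part. -/

theorem memℓp_weightedShift (σ : Equiv.Perm Q) (T : Q → K →L[ℂ] K) {C : ℝ}
    (hT : ∀ q, ‖T q‖ ≤ C) (ξ : lp (fun _ : Q => K) 2) :
    Memℓp (fun q => T q (ξ (σ.symm q))) 2 := by
  have h2 : 0 < (2 : ℝ≥0∞).toReal := by norm_num
  refine memℓp_gen ?_
  have hs : Summable fun q => C ^ (2 : ℝ≥0∞).toReal * ‖ξ (σ.symm q)‖ ^ (2 : ℝ≥0∞).toReal :=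
    (σ.symm.summable_iff.2 ((lp.memℓp ξ).summable h2)).mul_left _
  refine Summable.of_nonneg_of_le (fun q => by positivity) (fun q => ?_) hs
  have hC : 0 ≤ C := (norm_nonneg _).trans (hT q)
  rw [← Real.mul_rpow hC (norm_nonneg _)]
  exact Real.rpow_le_rpow (norm_nonneg _) ((T q).le_of_opNorm_le (hT q) _) h2.le

theorem norm_weightedShift_le (σ : Equiv.Perm Q) (T : Q → K →L[ℂ] K) {C : ℝ}
    (hT : ∀ q, ‖T q‖ ≤ C) (ξ : lp (fun _ : Q => K) 2) :
    ‖(⟨fun q => T q (ξ (σ.symm q)), memℓp_weightedShift σ T hT ξ⟩ : lp (fun _ : Q => K) 2)‖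
      ≤ max C 0 * ‖ξ‖ := by
  have h2 : 0 < (2 : ℝ≥0∞).toReal := by norm_num
  -- `C` may be negative when `Q` is empty, hence the maximum with `0`.
  have hC : 0 ≤ max C 0 := le_max_right _ _
  refine lp.norm_le_of_tsum_le h2 (by positivity) ?_
  rw [Real.mul_rpow hC (norm_nonneg _), lp.norm_rpow_eq_tsum h2, ← tsum_mul_left,
    ← σ.symm.tsum_eq fun q => max C 0 ^ (2 : ℝ≥0∞).toReal * ‖ξ q‖ ^ (2 : ℝ≥0∞).toReal]
  refine Summable.tsum_le_tsum (fun q => ?_) ((memℓp_weightedShift σ T hT ξ).summable h2)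
    ((σ.symm.summable_iff.2 ((lp.memℓp ξ).summable h2)).mul_left _)
  rw [← Real.mul_rpow hC (norm_nonneg _)]
  exact Real.rpow_le_rpow (norm_nonneg _)
    ((T q).le_of_opNorm_le ((hT q).trans (le_max_left _ _)) _) h2.le

/-- The operator `ξ ↦ (q ↦ T q (ξ (σ⁻¹ q)))` on the square-summable families, for a permutation
`σ` and a bounded family of operators `T`. -/
def weightedShift (σ : Equiv.Perm Q) (T : Q → K →L[ℂ] K) (C : ℝ) (hT : ∀ q, ‖T q‖ ≤ C) :
    lp (fun _ : Q => K) 2 →L[ℂ] lp (fun _ : Q => K) 2 :=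
  LinearMap.mkContinuous
    { toFun := fun ξ => ⟨fun q => T q (ξ (σ.symm q)), memℓp_weightedShift σ T hT ξ⟩
      map_add' := fun _ _ => lp.ext (funext fun q => map_add (T q) _ _)
      map_smul' := fun c _ => lp.ext (funext fun q => map_smul (T q) c _) }
    (max C 0) (norm_weightedShift_le σ T hT)

theorem weightedShift_apply (σ : Equiv.Perm Q) (T : Q → K →L[ℂ] K) (C : ℝ)
    (hT : ∀ q, ‖T q‖ ≤ C) (ξ : lp (fun _ : Q => K) 2) (q : Q) :
    weightedShift σ T C hT ξ q = T q (ξ (σ.symm q)) := rfl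

theorem star_weightedShift [CompleteSpace K] {σ τ : Equiv.Perm Q} {S T : Q → K →L[ℂ] K}
    {C D : ℝ} (hS : ∀ q, ‖S q‖ ≤ C) (hT : ∀ q, ‖T q‖ ≤ D) (hστ : τ = σ.symm)
    (h : ∀ q, T q = star (S (σ q))) :
    star (weightedShift σ S C hS) = weightedShift τ T D hT := by
  subst hστ
  symm
  rw [ContinuousLinearMap.star_eq_adjoint, ContinuousLinearMap.eq_adjoint_iff]
  intro ξ η
  rw [lp.inner_eq_tsum, lp.inner_eq_tsum]
  refine Eq.trans (tsum_congr fun q => ?_) (σ.tsum_eq _)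
  rw [weightedShift_apply, weightedShift_apply, h, ContinuousLinearMap.star_eq_adjoint,
    ContinuousLinearMap.adjoint_inner_left, Equiv.symm_symm, Equiv.symm_apply_apply]

end WeightedShift

universe u v

variable {A : Type u} [NonUnitalCStarAlgebra A] {H : Type v} [Group H]
  (β : H →* (A ≃⋆ₐ[ℂ] A)) (L : Subgroup H)

/-! ### Induction of covariant representations from `L` to `H`. -/

section Induced

variable {L} {s : H ⧸ L → H}

/-- Both `s q` and `h * s (h⁻¹ • q)` represent the coset `q`. -/
theorem cocycle_mem (hs : ∀ q, (s q : H ⧸ L) = q) (h : H) (q : H ⧸ L) :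
    (s q)⁻¹ * (h * s (h⁻¹ • q)) ∈ L := by
  rw [← QuotientGroup.eq, hs, ← smul_eq_mul, ← MulAction.Quotient.smul_coe, hs, smul_inv_smul]

variable (hs : ∀ q, (s q : H ⧸ L) = q)

/-- The cocycle `(h, q) ↦ s(q)⁻¹ h s(h⁻¹ q)` of a section `s` of `H → H ⧸ L`. -/
def cocycle (h : H) (q : H ⧸ L) : L := ⟨(s q)⁻¹ * (h * s (h⁻¹ • q)), cocycle_mem hs h q⟩

theorem cocycle_one (q : H ⧸ L) : cocycle hs 1 q = 1 :=
  Subtype.ext (by simp [cocycle])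

theorem cocycle_mul (h k : H) (q : H ⧸ L) :
    cocycle hs (h * k) q = cocycle hs h q * cocycle hs k (h⁻¹ • q) :=
  Subtype.ext (by simp [cocycle, mul_assoc, mul_smul])

variable {β} (ρ : CovariantRep (restrictAction β L))

theorem norm_unitary_le {K : Type*} [NormedAddCommGroup K] [InnerProductSpace ℂ K]
    [CompleteSpace K] (U : unitary (K →L[ℂ] K)) : ‖(U : K →L[ℂ] K)‖ ≤ 1 := by
  rw [← one_mul (U : K →L[ℂ] K), CStarRing.norm_mul_coe_unitary]
  exact ContinuousLinearMap.norm_id_le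

theorem coe_U_inv {β : H →* (A ≃⋆ₐ[ℂ] A)} (ρ : CovariantRep β) (h : H) :
    (ρ.U h⁻¹ : ρ.K →L[ℂ] ρ.K) = star (ρ.U h : ρ.K →L[ℂ] ρ.K) := by
  rw [map_inv, ← Unitary.star_eq_inv, Unitary.coe_star]

theorem norm_inducedπ_le (s : H ⧸ L → H) (a : A) (q : H ⧸ L) :
    ‖ρ.π (β (s q)⁻¹ a)‖ ≤ ‖a‖ :=
  (NonUnitalStarAlgHom.norm_apply_le ρ.π _).trans
    (NonUnitalStarAlgHom.norm_apply_le (β (s q)⁻¹ : A →⋆ₙₐ[ℂ] A) a)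

/-- The representation of the algebra in the induced covariant representation. -/
def inducedπ (s : H ⧸ L → H) :
    A →⋆ₙₐ[ℂ] (lp (fun _ : H ⧸ L => ρ.K) 2 →L[ℂ] lp (fun _ : H ⧸ L => ρ.K) 2) where
  toFun a := weightedShift 1 (fun q => ρ.π (β (s q)⁻¹ a)) ‖a‖ (norm_inducedπ_le ρ s a)
  map_smul' c a := by
    ext ξ q
    change ρ.π (β (s q)⁻¹ (c • a)) (ξ q) = c • ρ.π (β (s q)⁻¹ a) (ξ q)
    rw [map_smul, map_smul]; rfl
  map_zero' := by
    ext ξ q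
    change ρ.π (β (s q)⁻¹ 0) (ξ q) = 0
    rw [map_zero, map_zero]; rfl
  map_add' a b := by
    ext ξ q
    change ρ.π (β (s q)⁻¹ (a + b)) (ξ q) = ρ.π (β (s q)⁻¹ a) (ξ q) + ρ.π (β (s q)⁻¹ b) (ξ q)
    rw [map_add, map_add]; rfl
  map_mul' a b := by
    ext ξ q
    change ρ.π (β (s q)⁻¹ (a * b)) (ξ q) = ρ.π (β (s q)⁻¹ a) (ρ.π (β (s q)⁻¹ b) (ξ q))
    rw [map_mul, map_mul]; rfl
  map_star' a := (star_weightedShift (σ := 1) (τ := 1) (norm_inducedπ_le ρ s a)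
    (norm_inducedπ_le ρ s (star a)) rfl fun q => by
      rw [Equiv.Perm.one_apply, map_star, map_star]).symm

/-- The operators of the induced unitary representation. -/
def inducedOp (h : H) : lp (fun _ : H ⧸ L => ρ.K) 2 →L[ℂ] lp (fun _ : H ⧸ L => ρ.K) 2 :=
  weightedShift (MulAction.toPerm h) (fun q => (ρ.U (cocycle hs h q) : ρ.K →L[ℂ] ρ.K)) 1
    fun _ => norm_unitary_le _

theorem inducedOp_apply (h : H) (ξ : lp (fun _ : H ⧸ L => ρ.K) 2) (q : H ⧸ L) :
    inducedOp hs ρ h ξ q = (ρ.U (cocycle hs h q) : ρ.K →L[ℂ] ρ.K) (ξ (h⁻¹ • q)) := rfl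

theorem inducedOp_one : inducedOp hs ρ 1 = 1 := by
  ext ξ q
  rw [inducedOp_apply, cocycle_one, map_one, inv_one, one_smul]
  rfl

theorem inducedOp_mul (h k : H) :
    inducedOp hs ρ (h * k) = inducedOp hs ρ h * inducedOp hs ρ k := by
  ext ξ q
  rw [mul_apply_eq_comp, inducedOp_apply, inducedOp_apply, inducedOp_apply,
    cocycle_mul, map_mul, mul_inv_rev, mul_smul]
  rfl

theorem star_inducedOp (h : H) : star (inducedOp hs ρ h) = inducedOp hs ρ h⁻¹ := by
  refine star_weightedShift _ _ (by ext q; rfl) fun q => ?_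
  rw [← coe_U_inv]
  congr 3
  rw [eq_inv_iff_mul_eq_one, MulAction.toPerm_apply]
  -- The cocycle identity for `h⁻¹ * h = 1` makes the values at `(h⁻¹, q)` and `(h, h • q)` mutually
  -- inverse.
  simpa [cocycle_one] using (cocycle_mul hs h⁻¹ h q).symm

/-- The representation of `(A, H, β)` induced by a representation of `(A, L, β)`. -/
def inducedRep : CovariantRep β where
  K := lp (fun _ : H ⧸ L => ρ.K) 2
  π := inducedπ ρ s
  U :=
    { toFun h := ⟨inducedOp hs ρ h, by
        rw [Unitary.mem_iff, star_inducedOp, ← inducedOp_mul, ← inducedOp_mul, inv_mul_cancel,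
          mul_inv_cancel, inducedOp_one]
        exact ⟨rfl, rfl⟩⟩
      map_one' := Subtype.ext (inducedOp_one hs ρ)
      map_mul' h k := Subtype.ext (inducedOp_mul hs ρ h k) }
  covariant h a := by
    have key : inducedOp hs ρ h * inducedπ ρ s a = inducedπ ρ s (β h a) * inducedOp hs ρ h := by
      ext ξ q
      have e := ρ.U_mul_π (cocycle hs h q) (β (s (h⁻¹ • q))⁻¹ a)
      -- By definition of the cocycle `c`, `c(h, q) s(h⁻¹ q)⁻¹ = s(q)⁻¹ h`.
      have e' : restrictAction β L (cocycle hs h q) (β (s (h⁻¹ • q))⁻¹ a)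
          = β (s q)⁻¹ (β h a) := by
        change (β _ * β _) a = (β _ * β _) a
        rw [← map_mul, ← map_mul]
        simp [cocycle, mul_assoc]
      rw [e'] at e
      exact DFunLike.congr_fun e (ξ (h⁻¹ • q))
    change inducedOp hs ρ h * inducedπ ρ s a * star (inducedOp hs ρ h) = _
    rw [key, mul_assoc, star_inducedOp, ← inducedOp_mul, mul_inv_cancel, inducedOp_one, mul_one]

-- `L` fixes the trivial coset, and the normalisation `s 1 = 1` makes the cocycle there equal to `l`
-- and the twist of `π` trivial. So `ρ` sits unchanged inside its induced representation.
open Classical in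
theorem inducedRep_single (hs1 : s ((1 : H) : H ⧸ L) = 1) (a : A) (l : L) (ξ : ρ.K) :
    (inclusionOps β L (au (restrictAction β L) a l)) (inducedRep hs ρ)
        (lp.single 2 ((1 : H) : H ⧸ L) ξ)
      = lp.single 2 ((1 : H) : H ⧸ L) (au (restrictAction β L) a l ρ ξ) := by
  have hl : (l : H)⁻¹ • ((1 : H) : H ⧸ L) = ((1 : H) : H ⧸ L) := by
    rw [MulAction.Quotient.smul_coe, QuotientGroup.eq]; simp
  refine lp.ext (funext fun q => ?_)
  change ρ.π (β (s q)⁻¹ a) ((ρ.U (cocycle hs l q) : ρ.K →L[ℂ] ρ.K)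
    (lp.single (E := fun _ : H ⧸ L => ρ.K) 2 ((1 : H) : H ⧸ L) ξ ((l : H)⁻¹ • q))) = _
  by_cases hq : q = ((1 : H) : H ⧸ L)
  · subst hq
    have hc : cocycle hs l ((1 : H) : H ⧸ L) = l := Subtype.ext (by
      change (s _)⁻¹ * ((l : H) * s ((l : H)⁻¹ • ((1 : H) : H ⧸ L))) = l
      rw [hl, hs1]; simp)
    rw [hc, hl, hs1, lp.single_apply_self, lp.single_apply_self, inv_one, map_one]
    rfl
  · have hq' : (l : H)⁻¹ • q ≠ ((1 : H) : H ⧸ L) := fun h => hq <| by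
      rwa [← hl, smul_left_cancel_iff] at h
    rw [lp.single_apply_ne _ _ _ hq, lp.single_apply_ne _ _ _ hq', map_zero, map_zero]

end Induced

/-! ### The inclusion is isometric. -/

theorem continuous_apply_rep {β : H →* (A ≃⋆ₐ[ℂ] A)} (ρ : CovariantRep β) :
    Continuous fun T : UniversalOps β => T ρ :=
  (lp.lipschitzWith_one_eval (E := fun ρ : CovariantRep β => ρ.K →L[ℂ] ρ.K) ∞ ρ).continuous

theorem norm_apply_rep_le {β : H →* (A ≃⋆ₐ[ℂ] A)} (T : UniversalOps β) (ρ : CovariantRep β) :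
    ‖T ρ‖ ≤ ‖T‖ :=
  lp.norm_apply_le_norm (E := fun ρ : CovariantRep β => ρ.K →L[ℂ] ρ.K) ENNReal.top_ne_zero T ρ

/-- To prove a closed linear property for all elements of `A ⋊ H`, it is enough to prove it for
the elements `a u_h`. -/
theorem CrossedProduct.induction {β : H →* (A ≃⋆ₐ[ℂ] A)} {p : CrossedProduct β → Prop}
    (hau : ∀ a h, p (CrossedProduct.au β a h)) (hadd : ∀ x y, p x → p y → p (x + y))
    (hzero : p 0) (hsmul : ∀ (c : ℂ) x, p x → p (c • x)) (hcl : IsClosed {x | p x})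
    (x : CrossedProduct β) : p x := by
  have alg : ∀ y ∈ Submodule.span ℂ {x | ∃ (a : A) (h : H), x = CStarCrossed.au β a h},
      ∃ hy : y ∈ crossedProduct β, p ⟨y, hy⟩ := by
    intro y hy
    induction hy using Submodule.span_induction with
    | mem x hx => obtain ⟨a, h, rfl⟩ := hx; exact ⟨_, hau a h⟩
    | zero => exact ⟨zero_mem _, hzero⟩
    | add x y _ _ hx hy =>
      obtain ⟨hx, hpx⟩ := hx
      obtain ⟨hy, hpy⟩ := hy
      exact ⟨add_mem hx hy, hadd _ _ hpx hpy⟩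
    | smul c x _ hx =>
      obtain ⟨hx, hpx⟩ := hx
      exact ⟨SMulMemClass.smul_mem c hx, hsmul c _ hpx⟩
  have hemb : Topology.IsInducing (fun w : CrossedProduct β => w.1) :=
    (Topology.IsInducing.subtypeVal :
      Topology.IsInducing (Subtype.val : ↥(crossedProduct β) → UniversalOps β))
  refine closure_minimal (s := {w : CrossedProduct β | w.1 ∈ algCrossedProduct β})
    (fun w hw => (alg w.1 hw).2) hcl ?_
  rw [hemb.closure_eq_preimage_closure_image]
  refine closure_mono ?_ (x.2 : x.1 ∈ closure (algCrossedProduct β : Set (UniversalOps β)))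
  exact fun y hy => ⟨⟨y, (alg y hy).1⟩, hy, rfl⟩

open Classical in
theorem norm_le_norm_inclusion (T : CrossedProduct (restrictAction β L)) :
    ‖T‖ ≤ ‖inclusion β L T‖ := by
  change ‖T.1‖ ≤ ‖inclusionOps β L T.1‖
  obtain ⟨s, hs, hs1⟩ : ∃ s : H ⧸ L → H, (∀ q, (s q : H ⧸ L) = q) ∧
      s ((1 : H) : H ⧸ L) = 1 := by
    -- An arbitrary section, corrected at the trivial coset to take the value `1`.
    refine ⟨Function.update Quotient.out ((1 : H) : H ⧸ L) 1, fun q => ?_, by simp⟩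
    by_cases hq : q = ((1 : H) : H ⧸ L)
    · rw [hq, Function.update_self]
    · rw [Function.update_of_ne hq, QuotientGroup.out_eq']
  refine lp.norm_le_of_forall_le (norm_nonneg _) fun ρ => ?_
  have key : ∀ ξ : ρ.K, (inclusionOps β L T.1) (inducedRep hs ρ)
      (lp.single 2 ((1 : H) : H ⧸ L) ξ) = lp.single 2 ((1 : H) : H ⧸ L) (T.1 ρ ξ) := by
    intro ξ
    let ev (S : UniversalOps β) : lp (fun _ : H ⧸ L => ρ.K) 2 :=
      S (inducedRep hs ρ) (lp.single (E := fun _ : H ⧸ L => ρ.K) 2 ((1 : H) : H ⧸ L) ξ)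
    refine CrossedProduct.induction (p := fun T => (inclusionOps β L T.1) (inducedRep hs ρ)
      (lp.single 2 ((1 : H) : H ⧸ L) ξ) = lp.single 2 ((1 : H) : H ⧸ L) (T.1 ρ ξ))
      (fun a l => inducedRep_single hs ρ hs1 a l ξ) (fun x y hx hy => ?_) ?_ (fun c x hx => ?_)
      ?_ T
    · refine Eq.trans ?_ ((congrArg₂ (· + ·) hx hy).trans (lp.single_add _ _ _ _).symm)
      exact congrArg ev (map_add (inclusionOps β L) x.1 y.1)
    · exact (congrArg ev (map_zero (inclusionOps β L))).trans
        (lp.single_zero _ _).symm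
    · refine Eq.trans ?_ ((congrArg (c • ·) hx).trans (lp.single_smul _ _ _ _).symm)
      exact congrArg ev (map_smul (inclusionOps β L) c x.1)
    · refine isClosed_eq ?_ ?_
      · exact ((continuous_apply_rep (inducedRep hs ρ)).comp
          ((continuous_hom (inclusionOps β L)).comp
            (continuous_hom (CrossedProduct.val _)))).clm_apply continuous_const
      · exact (lp.isometry_single _).continuous.comp
          (((continuous_apply_rep ρ).comp
          (continuous_hom (CrossedProduct.val _))).clm_apply continuous_const)
  refine ContinuousLinearMap.opNorm_le_bound _ (norm_nonneg _) fun ξ => ?_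
  have h2 : (0 : ℝ≥0∞) < 2 := by norm_num
  -- Placing a vector in the trivial fibre preserves its norm, so the bound for the induced operator
  -- passes to `T ρ`.
  rw [← lp.norm_single (E := fun _ : H ⧸ L => ρ.K) h2 ((1 : H) : H ⧸ L) (T.1 ρ ξ), ← key,
    ← lp.norm_single (E := fun _ : H ⧸ L => ρ.K) h2 ((1 : H) : H ⧸ L) ξ]
  exact ContinuousLinearMap.le_of_opNorm_le _ (norm_apply_rep_le _ _) _

theorem isometry_inclusion : Isometry (inclusion β L) :=
  AddMonoidHomClass.isometry_of_norm _ fun x =>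
    le_antisymm (NonUnitalStarAlgHom.norm_apply_le _ _) (norm_le_norm_inclusion β L x)

end CStarCrossed

end

/-! ### Characters separating points from a subgroup. -/

noncomputable section

/-- The embedding of `ℚ / ℤ` into `ℝ / ℤ`. -/
def AddCircle.ratCast : AddCircle (1 : ℚ) →+ AddCircle (1 : ℝ) :=
  QuotientAddGroup.map _ _ (Rat.castHom ℝ).toAddMonoidHom <| by
    rw [AddSubgroup.zmultiples_le, AddSubgroup.mem_comap]
    exact (map_one (Rat.castHom ℝ)).symm ▸ AddSubgroup.mem_zmultiples (1 : ℝ)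

theorem AddCircle.eq_zero_of_ratCast_eq_zero {x : AddCircle (1 : ℚ)}
    (hx : AddCircle.ratCast x = 0) : x = 0 := by
  induction x using QuotientAddGroup.induction_on with
  | H z =>
    have h : ((z : ℝ) : AddCircle (1 : ℝ)) = 0 := hx
    rw [AddCircle.coe_eq_zero_iff] at h
    obtain ⟨n, hn⟩ := h
    refine (AddCircle.coe_eq_zero_iff (1 : ℚ)).2 ⟨n, ?_⟩
    rw [zsmul_one] at hn ⊢
    exact_mod_cast hn

/-- Characters with values in `ℚ / ℤ` separate points, and `ℚ / ℤ` embeds into `ℝ / ℤ` and so into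
the circle. -/
theorem exists_monoidHom_circle_ne_one {G : Type*} [CommGroup G] {g : G} (hg : g ≠ 1) :
    ∃ χ : G →* Circle, χ g ≠ 1 := by
  obtain ⟨c, hc⟩ := CharacterModule.exists_character_apply_ne_zero_of_ne_zero
    (A := Additive G) (a := Additive.ofMul g) (by simpa using hg)
  refine ⟨{ toFun := fun h => AddCircle.toCircle (AddCircle.ratCast (c (Additive.ofMul h)))
            map_one' := by simp
            map_mul' := fun h k => by rw [ofMul_mul, map_add, map_add, AddCircle.toCircle_add] },
    fun h => hc (AddCircle.eq_zero_of_ratCast_eq_zero ?_)⟩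
  exact AddCircle.injective_toCircle one_ne_zero (h.trans AddCircle.toCircle_zero.symm)

namespace CStarCrossed

/-- Pull back a character of `H ⧸ L` that is nontrivial at the class of `h`; it is continuous
because `H` is discrete. -/
theorem exists_mem_annihilator_ne_one {H : Type*} [CommGroup H] [TopologicalSpace H]
    [DiscreteTopology H] {L : Subgroup H} {h : H} (hh : h ∉ L) :
    ∃ x ∈ annihilator L, x h ≠ 1 := by
  obtain ⟨χ, hχ⟩ := exists_monoidHom_circle_ne_one (g := (h : H ⧸ L))
    (by rwa [Ne, QuotientGroup.eq_one_iff])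
  refine ⟨(⟨χ.comp (QuotientGroup.mk' L), continuous_of_discreteTopology⟩ : H →ₜ* Circle),
    fun l hl => ?_, hχ⟩
  change χ (l : H ⧸ L) = 1
  rw [(QuotientGroup.eq_one_iff l).2 hl, map_one]

/-- Equality in the triangle inequality would put `1` and `z` on one ray, and unit vectors on one
ray coincide. -/
theorem norm_one_add_div_two_lt_one {z : ℂ} (hz : ‖z‖ = 1) (hz1 : z ≠ 1) :
    ‖(1 + z) / 2‖ < 1 := by
  have h : ‖1 + z‖ < ‖(1 : ℂ)‖ + ‖z‖ := by
    refine lt_of_le_of_ne (norm_add_le _ _) fun h => hz1 ?_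
    rw [← sameRay_iff_norm_add, Complex.sameRay_iff] at h
    have := (sameRay_iff_norm_smul_eq (x := (1 : ℂ)) (y := z)).1 (Complex.sameRay_iff.2 h)
    simpa [hz, eq_comm] using this
  rw [norm_div, Complex.norm_two, div_lt_one two_pos]
  rw [norm_one, hz] at h
  linarith

universe u v

variable {A : Type u} [NonUnitalCStarAlgebra A] {H : Type v}

/-! ### Averages over the dual action. -/

section Average

variable [Group H] [TopologicalSpace H] (β : H →* (A ≃⋆ₐ[ℂ] A))

/-- The average of the identity and `β̂_x`. -/
def dualAverage (x : PontryaginDual H) : Module.End ℂ (CrossedProduct β) :=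
  (2⁻¹ : ℂ) • (LinearMap.id +
    ((dualEnd β x : CrossedProduct β →ₗ[ℂ] CrossedProduct β)))

theorem dualAverage_apply (x : PontryaginDual H) (b : CrossedProduct β) :
    dualAverage β x b = (2⁻¹ : ℂ) • (b + dualEnd β x b) := rfl

/-- The dual group is abelian, so the `β̂_x` commute. -/
theorem dualAverage_commute (x y : PontryaginDual H) :
    dualAverage β x * dualAverage β y = dualAverage β y * dualAverage β x := by
  have h (b : CrossedProduct β) : dualEnd β x (dualEnd β y b) = dualEnd β y (dualEnd β x b) := by
    rw [← NonUnitalStarAlgHom.comp_apply, ← dualEnd_mul, mul_comm, dualEnd_mul]; rfl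
  ext b
  simp only [Module.End.mul_apply, dualAverage_apply, map_smul, map_add, h]
  module

theorem dualAverage_au (x : PontryaginDual H) (a : A) (h : H) :
    dualAverage β x (CrossedProduct.au β a h)
      = ((1 + (starRingEnd ℂ (x h : ℂ))) / 2) • CrossedProduct.au β a h := by
  rw [dualAverage_apply, dualEnd_au]
  module

/-- The monoid of operators generated by the averages of the identity and the `β̂_x`, `x ∈ M`. -/
def dualAverages (M : Subgroup (PontryaginDual H)) : Submonoid (Module.End ℂ (CrossedProduct β)) :=
  Submonoid.closure (dualAverage β '' M)

variable {β} {M : Subgroup (PontryaginDual H)} {f g : Module.End ℂ (CrossedProduct β)}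

theorem norm_apply_le_of_mem_dualAverages (hf : f ∈ dualAverages β M) (b : CrossedProduct β) :
    ‖f b‖ ≤ ‖b‖ := by
  induction hf using Submonoid.closure_induction generalizing b with
  | mem f hf =>
    obtain ⟨x, -, rfl⟩ := hf
    rw [dualAverage_apply, norm_smul]
    have h1 : ‖dualEnd β x b‖ ≤ ‖b‖ := NonUnitalStarAlgHom.norm_apply_le _ _
    have h2 := norm_add_le b (dualEnd β x b)
    rw [norm_inv, Complex.norm_two]
    linarith
  | one => exact le_rfl
  | mul f g _ _ hf hg => exact (hf _).trans (hg b)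

theorem apply_eq_of_mem_dualAverages (hf : f ∈ dualAverages β M) {b : CrossedProduct β}
    (hb : b ∈ fixedPointAlgebra (dualAction β) M) : f b = b := by
  induction hf using Submonoid.closure_induction with
  | mem f hf =>
    obtain ⟨x, hx, rfl⟩ := hf
    have h : dualEnd β x b = b := hb x hx
    rw [dualAverage_apply, h]
    module
  | one => rfl
  | mul f g _ _ hf hg => rw [Module.End.mul_apply, hg, hf]

theorem commute_of_mem_dualAverages (hf : f ∈ dualAverages β M) (hg : g ∈ dualAverages β M) :
    f * g = g * f := by
  have : ∀ x ∈ dualAverage β '' (M : Set (PontryaginDual H)),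
      ∀ y ∈ dualAverage β '' (M : Set (PontryaginDual H)), x * y = y * x := by
    rintro _ ⟨x, -, rfl⟩ _ ⟨y, -, rfl⟩
    exact dualAverage_commute β x y
  have := Submonoid.isMulCommutative_closure _ this
  exact congrArg Subtype.val
    (mul_comm' (⟨f, hf⟩ : Submonoid.closure (dualAverage β '' M)) ⟨g, hg⟩)

end Average

/-! ### Fixed points of the annihilator. -/

variable [CommGroup H] [TopologicalSpace H] (β : H →* (A ≃⋆ₐ[ℂ] A)) (L : Subgroup H)

theorem inclusion_mem_fixedPointAlgebra (b : CrossedProduct (restrictAction β L)) :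
    inclusion β L b ∈ fixedPointAlgebra (dualAction β) (annihilator L) := by
  intro x hx
  change dualEnd β x (inclusion β L b) = _
  rw [← NonUnitalStarAlgHom.comp_apply]
  refine DFunLike.congr_fun (crossedProduct_hom_ext fun a l => ?_) b
  rw [NonUnitalStarAlgHom.comp_apply, inclusion_au, dualEnd_au, hx l l.2, Circle.coe_one, map_one,
    one_smul]

/-- The operator `f` may depend on `y` and `ε`; commuting contractions that fix the image of `A ⋊ L`
make the property linear and closed, so generators suffice. -/
theorem exists_dualAverages_norm_sub_lt [DiscreteTopology H] (y : CrossedProduct β) :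
    ∀ ε > 0, ∃ f ∈ dualAverages β (annihilator L), ∃ r, ‖f y - inclusion β L r‖ < ε := by
  have hfix {f} (hf : f ∈ dualAverages β (annihilator L)) (r) :
      f (inclusion β L r) = inclusion β L r :=
    apply_eq_of_mem_dualAverages hf (inclusion_mem_fixedPointAlgebra β L r)
  refine CrossedProduct.induction (p := fun y => ∀ ε > 0, ∃ f ∈ dualAverages β (annihilator L), ∃ r,
    ‖f y - inclusion β L r‖ < ε) (fun a h ε hε => ?_) (fun y z hy hz ε hε => ?_)
    (fun ε hε => ⟨1, one_mem _, 0, by simpa using hε⟩) (fun c y hy ε hε => ?_) ?_ y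
  · by_cases hh : h ∈ L
    · refine ⟨1, one_mem _, CrossedProduct.au _ a ⟨h, hh⟩, ?_⟩
      rw [inclusion_au, Module.End.one_apply, sub_self, norm_zero]
      exact hε
    · obtain ⟨x, hx, hx1⟩ := exists_mem_annihilator_ne_one hh
      -- The eigenvalue of the average on `a u_h`; its powers tend to zero.
      set z : ℂ := (1 + (starRingEnd ℂ (x h : ℂ))) / 2 with hz
      have hz1 : ‖z‖ < 1 := norm_one_add_div_two_lt_one
        (by rw [RCLike.norm_conj, Circle.norm_coe]) fun h1 => hx1 <| by
        rw [← map_one (starRingEnd ℂ)] at h1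
        exact Circle.ext ((starRingEnd ℂ).injective h1)
      have hpow (n : ℕ) : (dualAverage β x ^ n) (CrossedProduct.au β a h)
          = z ^ n • CrossedProduct.au β a h := by
        induction n with
        | zero => simp
        | succ n ih =>
          rw [pow_succ, Module.End.mul_apply, dualAverage_au, map_smul, ih, smul_smul, pow_succ']
      have hlim : Filter.Tendsto (fun n : ℕ => z ^ n • CrossedProduct.au β a h) Filter.atTop
          (nhds 0) := by
        simpa using (tendsto_pow_atTop_nhds_zero_of_norm_lt_one hz1).smul_const
          (CrossedProduct.au β a h)
      obtain ⟨n, hn⟩ := ((Metric.tendsto_nhds.1 hlim) ε hε).exists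
      refine ⟨dualAverage β x ^ n, 
        Submonoid.pow_mem _ (Submonoid.subset_closure (Set.mem_image_of_mem _ hx)) n, 0, ?_⟩
      rw [hpow, map_zero, ← dist_eq_norm]
      exact hn
  · obtain ⟨f, hf, r, hr⟩ := hy (ε / 2) (half_pos hε)
    obtain ⟨g, hg, s, hs⟩ := hz (ε / 2) (half_pos hε)
    refine ⟨f * g, mul_mem hf hg, r + s, ?_⟩
    -- Since `f` and `g` commute, each summand meets its own operator first; the other one fixes the
    -- approximant and does not increase the error.
    have e : (f * g) (y + z) - inclusion β L (r + s)
        = g (f y - inclusion β L r) + f (g z - inclusion β L s) := by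
      rw [map_add, map_add, map_sub, map_sub, hfix hf, hfix hg,
        commute_of_mem_dualAverages hf hg, Module.End.mul_apply,
        ← commute_of_mem_dualAverages hf hg, Module.End.mul_apply]
      abel
    rw [e]
    calc _ ≤ _ := norm_add_le _ _
      _ ≤ ‖f y - inclusion β L r‖ + ‖g z - inclusion β L s‖ :=
        add_le_add (norm_apply_le_of_mem_dualAverages hg _)
          (norm_apply_le_of_mem_dualAverages hf _)
      _ < ε := by linarith
  -- Adding `1` covers the case `c = 0`.
  · have hc : 0 < ‖c‖ + 1 := by positivity
    obtain ⟨f, hf, r, hr⟩ := hy (ε / (‖c‖ + 1)) (by positivity)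
    refine ⟨f, hf, c • r, ?_⟩
    rw [map_smul, map_smul, ← smul_sub, norm_smul]
    rw [lt_div_iff₀ hc] at hr
    nlinarith [norm_nonneg (f y - inclusion β L r)]
  -- The `f` and `r` found for a nearby `z` also serve `y`, as `f` is contractive.
  · refine isClosed_of_closure_subset fun y hy ε hε => ?_
    obtain ⟨z, hz, hyz⟩ := Metric.mem_closure_iff.1 hy (ε / 2) (half_pos hε)
    obtain ⟨f, hf, r, hr⟩ := hz (ε / 2) (half_pos hε)
    refine ⟨f, hf, r, ?_⟩
    have h1 := norm_apply_le_of_mem_dualAverages hf (y - z)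
    rw [map_sub, ← dist_eq_norm y z] at h1
    have h2 := norm_add_le (f y - f z) (f z - inclusion β L r)
    rw [sub_add_sub_cancel] at h2
    linarith

end CStarCrossed

end

theorem lemma2p3 {A : Type*} [NonUnitalCStarAlgebra A] {H : Type*} [CommGroup H]
    [TopologicalSpace H] [DiscreteTopology H] (β : H →* (A ≃⋆ₐ[ℂ] A)) (L : Subgroup H) :
    Isometry (CStarCrossed.inclusion β L) ∧
      NonUnitalStarAlgHom.range (CStarCrossed.inclusion β L) =
        CStarCrossed.fixedPointAlgebra (CStarCrossed.dualAction β)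
          (CStarCrossed.annihilator L) := by
  have hiso := CStarCrossed.isometry_inclusion β L
  refine ⟨hiso, le_antisymm ?_ fun b hb => ?_⟩
  · rintro _ ⟨b, rfl⟩
    exact CStarCrossed.inclusion_mem_fixedPointAlgebra β L b
  -- An isometric image of a complete space is closed.
  · have hcl : IsClosed (Set.range (CStarCrossed.inclusion β L)) :=
      hiso.isClosedEmbedding.isClosed_range
    change b ∈ Set.range (CStarCrossed.inclusion β L)
    rw [← hcl.closure_eq, Metric.mem_closure_range_iff]
    intro ε hε
    obtain ⟨f, hf, r, hr⟩ := CStarCrossed.exists_dualAverages_norm_sub_lt β L b ε hε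
    rw [CStarCrossed.apply_eq_of_mem_dualAverages hf hb] at hr
    exact ⟨r, by rwa [dist_eq_norm]⟩
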